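/- Let $\Theta\subset\mathbb R$ be closed and $\mathbf a:\Theta\to\mathbb C^m$ smooth, with derivative $\mathbf d=\mathrm d\mathbf a/\mathrm d\theta$. For distinct $\theta_1,\dots,\theta_n\in\Theta$ put $\mathbf A(\boldsymbol\theta)=[\mathbf a(\theta_1)\cdots\mathbf a(\theta_n)]$ and $\mathbf D(\boldsymbol\theta)=[\mathbf d(\theta_1)\cdots\mathbf d(\theta_n)]$. For $\mathbf S\in\mathbb C^{n\times T}$ with rows $\mathbf S_i$ let $\gamma_i=\|\mathbf S_i\|_2$, $\boldsymbol\Gamma_{\mathbf S}=\mathrm{diag}(\gamma_1,\dots,\gamma_n)$ and $\|\mathbf S\|_{1,2}=\sum_i\gamma_i$. A pair $(\boldsymbol\theta,\mathbf S)$ of order $n$ ($n$ distinct indexes in $\Theta$ and $\mathbf S\in\mathbb C^{n\times T}$) is irreducible if no row of $\mathbf S$ is zero; pairs are identified up to simultaneous permutation of the indexes and the rows. For data $\mathbf X\in\mathbb C^{m\times T}$ and $\lambda>0$, a CLASS solution is a minimizer of $\frac12\|\mathbf X-\mathbf A(\boldsymbol\theta)\mathbf S\|_F^2+\lambda\|\mathbf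 S\|_{1,2}$ over all irreducible pairs of arbitrary finite order. A noiseless CLASS solution is a minimizer of $\|\mathbf S\|_{1,2}$ over all irreducible pairs of arbitrary finite order with $\mathbf A(\boldsymbol\theta)\mathbf S=\mathbf X$. Let $(\boldsymbol\theta,\mathbf S)$ be true parameters of order $n$, with every $\theta_i$ in the interior of $\Theta$, and let $\mathbf X=\mathbf A(\boldsymbol\theta)\mathbf S$. Suppose that (i) $(\boldsymbol\theta,\mathbf S)$ is CLASS-consistent: it is the unique noiseless CLASS solution for $\mathbf X$; (ii) the case is pure: for all sufficiently small $\lambda>0$ there is a CLASS solution for $(\mathbf X,\lambda)$ of the same order $n$, and the indexes of these solutions stay in a bounded set as $\lambda\to0$ (which is automatic if $\Theta$ is bounded). Write $\mathbf A=\mathbf A(\boldsymbol\theta)$, $\mathbf D=\mathbf D(\boldsymbol\theta)$, $\mathbf d_i=\mathbf d(\theta_i)$, $\mathbf P_A^\perp=\mathbf I-\mathbf A(\mathbf A^H\mathbf A)^{-1}\mathbf A^H$, $\mathbf U=\boldsymbol\Gamma_{\mathbf S}^{-1}\mathbf S$, $\boldsymbol\Xi=\mathbf U\mathbf U^H=[\boldsymbol\xi_1\cdots\boldsymbol\xi_n]$,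 $\mathbf R=\mathrm{Re}[(\mathbf D^H\mathbf P_A^\perp\mathbf D)\odot\boldsymbol\Xi^T]$ with $\odot$ the entrywise product, $\boldsymbol\beta=\boldsymbol\Gamma_{\mathbf S}^{-1}\mathbf R^{-1}\big(\mathrm{Re}[\mathbf d_i^H\mathbf A(\mathbf A^H\mathbf A)^{-1}\boldsymbol\xi_i]\big)_{i=1}^n$, and let $\Delta Q_0$ be the diagonal matrix with the entries of $\boldsymbol\Gamma_{\mathbf S}\boldsymbol\beta$ on its diagonal; the matrices $\mathbf A^H\mathbf A$ and $\mathbf R$ are assumed invertible. Then, for every square root $\boldsymbol\Xi^{1/2}\in\mathbb C^{n\times n}$ of $\boldsymbol\Xi$ in the sense $\boldsymbol\Xi^{1/2}(\boldsymbol\Xi^{1/2})^H=\boldsymbol\Xi$ (in particular the positive semidefinite one), $$\big\|\mathbf a^H(\theta)\big(\mathbf P_A^\perp\mathbf D\,\Delta Q_0-\mathbf A(\mathbf A^H\mathbf A)^{-1}\big)\boldsymbol\Xi^{1/2}\big\|_2\le1\qquad\text{for every }\theta\in\Theta.$$ -/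

import Mathlib

open scoped Matrix ContDiff Topology
open Filter

noncomputable section

namespace CLASS

variable {m n T : ℕ}

/-- `A(θ) = [a(θ₁) … a(θₙ)]`. -/
def steering (a : ℝ → Fin m → ℂ) (θ : Fin n → ℝ) : Matrix (Fin m) (Fin n) ℂ :=
  Matrix.of fun k i => a (θ i) k

/-- The Euclidean norm of a complex vector. -/
def l2norm (v : Fin n → ℂ) : ℝ := ‖WithLp.toLp 2 v‖

/-- `γ_{i,S}`, the Euclidean norm of the `i`-th row. -/
def rowNorm (S : Matrix (Fin n) (Fin T) ℂ) (i : Fin n) : ℝ := l2norm (S i)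

/-- `‖S‖_{1,2}`. -/
def norm12 (S : Matrix (Fin n) (Fin T) ℂ) : ℝ := ∑ i, rowNorm S i

/-- `‖M‖_F²`. -/
def frobSq (M : Matrix (Fin m) (Fin T) ℂ) : ℝ := ∑ k, ∑ t, ‖M k t‖ ^ 2

/-- `Ψ(X, θ, S, lam) = ½‖X - A(θ)S‖_F² + lam ‖S‖_{1,2}`. -/
def cost (a : ℝ → Fin m → ℂ) (X : Matrix (Fin m) (Fin T) ℂ) (lam : ℝ)
    (θ : Fin n → ℝ) (S : Matrix (Fin n) (Fin T) ℂ) : ℝ :=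
  1 / 2 * frobSq (X - steering a θ * S) + lam * norm12 S

/-- `θ` lists the distinct elements of an `n`-element subset of `Θ`, and the pair `(θ, S)` is
irreducible: no row of `S` is zero. -/
def IsIrreducible (Θ : Set ℝ) (θ : Fin n → ℝ) (S : Matrix (Fin n) (Fin T) ℂ) : Prop :=
  Function.Injective θ ∧ (∀ i, θ i ∈ Θ) ∧ ∀ i, S i ≠ 0

/-- `(θ, S)` solves the CLASS optimization for the data `X` and regularization parameter `lam`:
it minimizes the cost over all irreducible pairs, of any order `k`. -/
def IsSolution (a : ℝ → Fin m → ℂ) (Θ : Set ℝ) (X : Matrix (Fin m) (Fin T) ℂ) (lam : ℝ)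
    (θ : Fin n → ℝ) (S : Matrix (Fin n) (Fin T) ℂ) : Prop :=
  IsIrreducible Θ θ S ∧
    ∀ (k : ℕ) (θ' : Fin k → ℝ) (S' : Matrix (Fin k) (Fin T) ℂ),
      IsIrreducible Θ θ' S' → cost a X lam θ S ≤ cost a X lam θ' S'

/-- `(θ, S)` solves the noiseless CLASS optimization for the data `X`: it minimizes `‖S‖_{1,2}`
over all irreducible pairs, of any order `k`, that represent `X` exactly. -/
def IsNoiselessSolution (a : ℝ → Fin m → ℂ) (Θ : Set ℝ) (X : Matrix (Fin m) (Fin T) ℂ)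
    (θ : Fin n → ℝ) (S : Matrix (Fin n) (Fin T) ℂ) : Prop :=
  IsIrreducible Θ θ S ∧ steering a θ * S = X ∧
    ∀ (k : ℕ) (θ' : Fin k → ℝ) (S' : Matrix (Fin k) (Fin T) ℂ),
      IsIrreducible Θ θ' S' → steering a θ' * S' = X → norm12 S ≤ norm12 S'

/-- The parameters `(θ, S)` are CLASS-consistent: for the noiseless data `A(θ)S` that they generate,
`(θ, S)` is the solution of noiseless CLASS, unique up to the order of listing the indexes. -/
def IsConsistent (a : ℝ → Fin m → ℂ) (Θ : Set ℝ)
    (θ : Fin n → ℝ) (S : Matrix (Fin n) (Fin T) ℂ) : Prop :=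
  IsNoiselessSolution a Θ (steering a θ * S) θ S ∧
    ∀ (k : ℕ) (θ' : Fin k → ℝ) (S' : Matrix (Fin k) (Fin T) ℂ),
      IsNoiselessSolution a Θ (steering a θ * S) θ' S' →
        ∃ e : Fin k ≃ Fin n, θ' = θ ∘ e ∧ S' = S.submatrix e id

/-- The case of the true parameters `(θ, S)` of order `n` is pure: for the noiseless data `A(θ)S`
and all sufficiently small `lam > 0`, CLASS has a solution of the same order `n`. The indexes of
these solutions are to stay in a bounded set, which is automatic when `Θ` is bounded. -/
def IsPure (a : ℝ → Fin m → ℂ) (Θ : Set ℝ)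
    (θ : Fin n → ℝ) (S : Matrix (Fin n) (Fin T) ℂ) : Prop :=
  ∃ C : ℝ, ∀ᶠ lam : ℝ in 𝓝[>] 0,
    ∃ (θ' : Fin n → ℝ) (S' : Matrix (Fin n) (Fin T) ℂ),
      IsSolution a Θ (steering a θ * S) lam θ' S' ∧ ∀ i, |θ' i| ≤ C

/-- `D(θ) = [d(θ₁) … d(θₙ)]` with `d = da/dθ`. -/
def derivSteering (a : ℝ → Fin m → ℂ) (θ : Fin n → ℝ) : Matrix (Fin m) (Fin n) ℂ :=
  steering (deriv a) θ

/-- `Γ_S = diag(γ_{1,S}, …, γ_{n,S})`. -/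
def Gam (S : Matrix (Fin n) (Fin T) ℂ) : Matrix (Fin n) (Fin n) ℝ :=
  Matrix.diagonal (rowNorm S)

/-- `U = Γ_S⁻¹ S`, the matrix of normalized rows. -/
def normalized (S : Matrix (Fin n) (Fin T) ℂ) : Matrix (Fin n) (Fin T) ℂ :=
  (Gam S)⁻¹.map Complex.ofReal * S

/-- `Ξ = U Uᴴ`. -/
def Xi (S : Matrix (Fin n) (Fin T) ℂ) : Matrix (Fin n) (Fin n) ℂ :=
  normalized S * (normalized S)ᴴ

/-- `P_A^⊥ = I - A (AᴴA)⁻¹ Aᴴ`. -/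
def projPerp (A : Matrix (Fin m) (Fin n) ℂ) : Matrix (Fin m) (Fin m) ℂ :=
  1 - A * (Aᴴ * A)⁻¹ * Aᴴ

/-- `R = Re[(Dᴴ P_A^⊥ D) ⊙ Ξᵀ]`. -/
def Rmat (a : ℝ → Fin m → ℂ) (θ : Fin n → ℝ) (S : Matrix (Fin n) (Fin T) ℂ) :
    Matrix (Fin n) (Fin n) ℝ :=
  (((derivSteering a θ)ᴴ * projPerp (steering a θ) * derivSteering a θ) ⊙ (Xi S)ᵀ).map Complex.re

/-- The vector with entries `Re(d_iᴴ A (AᴴA)⁻¹ ξ_i)`, where `ξ_i` is the `i`-th column of `Ξ`. -/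
def biasVec (a : ℝ → Fin m → ℂ) (θ : Fin n → ℝ) (S : Matrix (Fin n) (Fin T) ℂ) : Fin n → ℝ :=
  fun i => (star (deriv a (θ i)) ⬝ᵥ
    ((steering a θ * ((steering a θ)ᴴ * steering a θ)⁻¹) *ᵥ (fun j => Xi S j i))).re

/-- `β = Γ_S⁻¹ R⁻¹ Re[d_iᴴ A (AᴴA)⁻¹ ξ_i]_i`. -/
def beta (a : ℝ → Fin m → ℂ) (θ : Fin n → ℝ) (S : Matrix (Fin n) (Fin T) ℂ) : Fin n → ℝ :=
  (Gam S)⁻¹ *ᵥ ((Rmat a θ S)⁻¹ *ᵥ biasVec a θ S)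

/-- `ΔQ₀`, the diagonal matrix of the elements of `Γ_S β`. -/
def deltaQ0 (a : ℝ → Fin m → ℂ) (θ : Fin n → ℝ) (S : Matrix (Fin n) (Fin T) ℂ) :
    Matrix (Fin n) (Fin n) ℂ :=
  Matrix.diagonal fun i => (((Gam S *ᵥ beta a θ S) i : ℝ) : ℂ)

end CLASS

end

/-! For a CLASS solution `(θ', S')` the residual `E = X - A(θ')S'` satisfies `‖a(ϑ)ᴴ E‖ ≤ lam` on
`Θ`, since otherwise adding a small source at `ϑ` would lower the cost. At `ϑ = θ'ᵢ` there is
equality, so `a(θ'ᵢ)ᴴ E` is `lam` times the `i`-th normalized row of `S'` and, at an interior index,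
the derivative in `ϑ` of `Re(a(ϑ)ᴴ E S'ᵢᴴ)` vanishes. Writing `A(θ') - A(θ)` as an exact matrix of
difference quotients times `diag(θ' - θ)`, the first equation expresses `E` through `θ' - θ` and the
second becomes a linear system for `θ' - θ`. Along pure solutions, which by compactness and
consistency accumulate at the true parameters as `lam → 0`, the matrix of that system tends to
`R Γ_S`, while its right-hand side is `lam` times a vector tending to the bias vector. Hence
`(θ' - θ) / lam → β`, the quotient `E / lam` has the limit `-(P_A^⊥ D ΔQ₀ - A (AᴴA)⁻¹) U`, and the
dual bound passes to the limit. -/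

noncomputable section

namespace CLASS

section InnerProduct

variable {E : Type*} [NormedAddCommGroup E] [InnerProductSpace ℝ E]

theorem eq_smul_of_norm_le_of_le_inner {v w : E} {r : ℝ} (hv : v ≠ 0) (hw : ‖w‖ ≤ r)
    (h : r * ‖v‖ ≤ inner ℝ v w) : w = (r * ‖v‖⁻¹) • v := by
  have hv' : 0 < ‖v‖ := norm_pos_iff.2 hv
  have hcs : inner ℝ v w ≤ ‖v‖ * ‖w‖ := real_inner_le_norm v w
  have hr : ‖w‖ = r :=
    hw.antisymm (le_of_mul_le_mul_right (h.trans (hcs.trans_eq (mul_comm _ _))) hv')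
  have heq : ‖w‖ • v = ‖v‖ • w :=
    inner_eq_norm_mul_iff_real.1 (hcs.antisymm (by rwa [hr, mul_comm]))
  rw [mul_comm, mul_smul, ← hr, heq, inv_smul_smul₀ hv'.ne']

end InnerProduct

theorem nonneg_of_forall_quadratic_nonneg {c d : ℝ}
    (h : ∀ t : ℝ, 0 < t → t ≤ 1 → 0 ≤ t * c + t ^ 2 * d) : 0 ≤ c := by
  have hslope : ∀ᶠ t : ℝ in 𝓝[>] 0, 0 ≤ c + t * d := by
    filter_upwards [Ioc_mem_nhdsGT zero_lt_one] with t ht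
    refine nonneg_of_mul_nonneg_right ?_ ht.1
    linarith [h t ht.1 ht.2]
  have hlim : Tendsto (fun t : ℝ => c + t * d) (𝓝[>] 0) (𝓝 (c + 0 * d)) :=
    (Continuous.tendsto (by fun_prop) 0).mono_left nhdsWithin_le_nhds
  simpa using ge_of_tendsto hlim hslope

theorem exists_tendsto_of_frequently {ι Y : Type*} [TopologicalSpace Y] {l : Filter ι} {K : Set Y}
    (hK : IsCompact K) {p : ι → Y → Prop} (h : ∃ᶠ k in l, ∃ y ∈ K, p k y) :
    ∃ F ≤ l, F.NeBot ∧ ∃ (f : ι → Y) (y : Y), y ∈ K ∧ Tendsto f F (𝓝 y) ∧ ∀ᶠ k in F, p k (f k) := by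
  obtain ⟨-, y₀, -⟩ := h.exists
  have : Nonempty Y := ⟨y₀⟩
  choose! f hf using fun (k : ι) (hk : ∃ y, y ∈ K ∧ p k y) => hk
  have : (l ⊓ 𝓟 {k | ∃ y ∈ K, p k y}).NeBot := frequently_iff_neBot.1 h
  have hmem : ∀ᶠ k in l ⊓ 𝓟 {k | ∃ y ∈ K, p k y}, f k ∈ K ∧ p k (f k) :=
    mem_inf_of_right fun k hk => hf k hk
  obtain ⟨y, hy, hclus⟩ := hK.exists_mapClusterPt (u := f)
    (tendsto_principal.2 (hmem.mono fun _ hk => hk.1))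
  obtain ⟨U, hU, hlim⟩ := mapClusterPt_iff_ultrafilter.1 hclus
  exact ⟨U, hU.trans inf_le_left, U.neBot, f, y, hy, hlim, hU (hmem.mono fun _ hk => hk.2)⟩

section MatrixLimits

variable {ι l m n R : Type*} {F : Filter ι}

theorem tendsto_matrix_mul [Fintype m] [NonUnitalNonAssocSemiring R] [TopologicalSpace R]
    [IsTopologicalSemiring R] {M : ι → Matrix l m R} {N : ι → Matrix m n R} {M₀ : Matrix l m R}
    {N₀ : Matrix m n R} (hM : Tendsto M F (𝓝 M₀)) (hN : Tendsto N F (𝓝 N₀)) :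
    Tendsto (fun k => M k * N k) F (𝓝 (M₀ * N₀)) :=
  ((continuous_fst.matrix_mul continuous_snd).tendsto (M₀, N₀)).comp (hM.prodMk_nhds hN)

theorem tendsto_matrix_conjTranspose [Star R] [TopologicalSpace R] [ContinuousStar R]
    {M : ι → Matrix m n R} {M₀ : Matrix m n R} (hM : Tendsto M F (𝓝 M₀)) :
    Tendsto (fun k => (M k)ᴴ) F (𝓝 M₀ᴴ) :=
  (continuous_id.matrix_conjTranspose.tendsto M₀).comp hM

variable {𝕜 : Type*} [NormedField 𝕜] [Fintype n] [DecidableEq n]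

theorem eventually_isUnit_det {M : ι → Matrix n n 𝕜} {M₀ : Matrix n n 𝕜}
    (hM : Tendsto M F (𝓝 M₀)) (hM₀ : IsUnit M₀.det) : ∀ᶠ k in F, IsUnit (M k).det :=
  (((continuous_id.matrix_det.tendsto M₀).comp hM).eventually_ne hM₀.ne_zero).mono
    fun _ hk => hk.isUnit

theorem tendsto_matrix_inv {M : ι → Matrix n n 𝕜} {M₀ : Matrix n n 𝕜}
    (hM : Tendsto M F (𝓝 M₀)) (hM₀ : IsUnit M₀.det) : Tendsto (fun k => (M k)⁻¹) F (𝓝 M₀⁻¹) := by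
  refine (continuousAt_matrix_inv M₀ ?_).tendsto.comp hM
  simpa only [Ring.inverse_eq_inv'] using continuousAt_inv₀ hM₀.ne_zero

theorem tendsto_of_mulVec_eq {M : ι → Matrix n n 𝕜} {M₀ : Matrix n n 𝕜} {x b : ι → n → 𝕜}
    {b₀ : n → 𝕜} (hM : Tendsto M F (𝓝 M₀)) (hM₀ : IsUnit M₀.det) (hb : Tendsto b F (𝓝 b₀))
    (h : ∀ᶠ k in F, M k *ᵥ x k = b k) : Tendsto x F (𝓝 (M₀⁻¹ *ᵥ b₀)) := by
  have hinv := tendsto_matrix_inv hM hM₀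
  have hlim : Tendsto (fun k => (M k)⁻¹ *ᵥ b k) F (𝓝 (M₀⁻¹ *ᵥ b₀)) :=
    tendsto_pi_nhds.2 fun i => tendsto_finsetSum _ fun j _ =>
      ((hinv.apply_nhds i).apply_nhds j).mul (hb.apply_nhds j)
  refine hlim.congr' ?_
  filter_upwards [h, eventually_isUnit_det hM hM₀] with k hk hunit
  rw [← hk, Matrix.mulVec_mulVec, Matrix.nonsing_inv_mul _ hunit, Matrix.one_mulVec]

end MatrixLimits

section Norms

variable {m n T : ℕ}

theorem l2norm_nonneg (v : Fin n → ℂ) : 0 ≤ l2norm v := norm_nonneg _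

theorem l2norm_pos {v : Fin n → ℂ} (hv : v ≠ 0) : 0 < l2norm v :=
  norm_pos_iff.2 ((WithLp.toLp_eq_zero 2).not.2 hv)

theorem l2norm_add_le (v w : Fin n → ℂ) : l2norm (v + w) ≤ l2norm v + l2norm w :=
  norm_add_le (WithLp.toLp 2 v) (WithLp.toLp 2 w)

theorem l2norm_neg (v : Fin n → ℂ) : l2norm (-v) = l2norm v :=
  norm_neg (WithLp.toLp 2 v)

theorem l2norm_smul (c : ℝ) (v : Fin n → ℂ) : l2norm (c • v) = |c| * l2norm v :=
  norm_smul c (WithLp.toLp 2 v)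

theorem continuous_l2norm : Continuous (l2norm : (Fin n → ℂ) → ℝ) :=
  (PiLp.continuous_toLp 2 _).norm

theorem re_dotProduct_star_eq_inner (w v : Fin n → ℂ) :
    (w ⬝ᵥ star v).re = inner ℝ (WithLp.toLp 2 v) (WithLp.toLp 2 w) := by
  simp only [PiLp.inner_apply, Complex.inner, dotProduct, Complex.re_sum, Pi.star_apply,
    Complex.star_def]

theorem re_dotProduct_star_self (v : Fin n → ℂ) : (v ⬝ᵥ star v).re = l2norm v ^ 2 := by
  rw [re_dotProduct_star_eq_inner, real_inner_self_eq_norm_sq, l2norm]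

theorem eq_smul_of_l2norm_le_of_le_re_dotProduct {v w : Fin n → ℂ} {r : ℝ} (hv : v ≠ 0)
    (hw : l2norm w ≤ r) (h : r * l2norm v ≤ (w ⬝ᵥ star v).re) :
    w = (r * (l2norm v)⁻¹) • v := by
  rw [re_dotProduct_star_eq_inner] at h
  exact congrArg WithLp.ofLp
    (eq_smul_of_norm_le_of_le_inner ((WithLp.toLp_eq_zero 2).not.2 hv) hw h)

theorem l2norm_vecMul_eq_of_mul_conjTranspose_eq {p q : ℕ} (v : Fin n → ℂ)
    {V : Matrix (Fin n) (Fin p) ℂ} {W : Matrix (Fin n) (Fin q) ℂ} (h : V * Vᴴ = W * Wᴴ) :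
    l2norm (v ᵥ* V) = l2norm (v ᵥ* W) := by
  have hsq : ∀ {r : ℕ} (Y : Matrix (Fin n) (Fin r) ℂ),
      l2norm (v ᵥ* Y) ^ 2 = (v ᵥ* (Y * Yᴴ) ⬝ᵥ star v).re := fun Y => by
    rw [← re_dotProduct_star_self, Matrix.star_vecMul, Matrix.dotProduct_mulVec,
      Matrix.vecMul_vecMul]
  rw [← pow_left_inj₀ (l2norm_nonneg _) (l2norm_nonneg _) two_ne_zero, hsq, hsq, h]

theorem rowNorm_nonneg (S : Matrix (Fin n) (Fin T) ℂ) (i : Fin n) : 0 ≤ rowNorm S i :=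
  l2norm_nonneg _

theorem rowNorm_pos {S : Matrix (Fin n) (Fin T) ℂ} {i : Fin n} (hi : S i ≠ 0) : 0 < rowNorm S i :=
  l2norm_pos hi

theorem norm_apply_le_norm12 (S : Matrix (Fin n) (Fin T) ℂ) (i : Fin n) (t : Fin T) :
    ‖S i t‖ ≤ norm12 S :=
  calc ‖S i t‖ ≤ rowNorm S i := PiLp.norm_apply_le (WithLp.toLp 2 (S i)) t
    _ ≤ norm12 S := Finset.single_le_sum (fun i _ => rowNorm_nonneg S i) (Finset.mem_univ i)

theorem norm12_nonneg (S : Matrix (Fin n) (Fin T) ℂ) : 0 ≤ norm12 S :=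
  Finset.sum_nonneg fun i _ => rowNorm_nonneg S i

theorem norm12_add_le (S S' : Matrix (Fin n) (Fin T) ℂ) :
    norm12 (S + S') ≤ norm12 S + norm12 S' := by
  rw [norm12, norm12, norm12, ← Finset.sum_add_distrib]
  exact Finset.sum_le_sum fun i _ => l2norm_add_le (S i) (S' i)

theorem norm12_smul (c : ℝ) (S : Matrix (Fin n) (Fin T) ℂ) : norm12 (c • S) = |c| * norm12 S := by
  rw [norm12, norm12, Finset.mul_sum]
  exact Finset.sum_congr rfl fun i _ => l2norm_smul c (S i)

theorem norm12_single (i : Fin n) (v : Fin T → ℂ) :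
    norm12 (Matrix.of (Pi.single i v)) = l2norm v := by
  have hrow : ∀ j, rowNorm (Matrix.of (Pi.single i v)) j =
      (Pi.single i (l2norm v) : Fin n → ℝ) j :=
    Pi.apply_single (fun _ => l2norm) (fun _ => norm_zero) i v
  rw [norm12, Finset.sum_congr rfl fun j _ => hrow j, Finset.sum_pi_single',
    if_pos (Finset.mem_univ i)]

theorem norm12_append {k : ℕ} (S : Matrix (Fin n) (Fin T) ℂ) (S' : Matrix (Fin k) (Fin T) ℂ) :
    norm12 (Matrix.of (Fin.append S S')) = norm12 S + norm12 S' := by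
  have hleft : ∀ i, rowNorm (Matrix.of (Fin.append S S')) (Fin.castAdd k i) = rowNorm S i :=
    fun i => congrArg l2norm (Fin.append_left S S' i)
  have hright : ∀ i, rowNorm (Matrix.of (Fin.append S S')) (Fin.natAdd n i) = rowNorm S' i :=
    fun i => congrArg l2norm (Fin.append_right S S' i)
  simp only [norm12, Fin.sum_univ_add, hleft, hright]

theorem norm12_succAbove (S : Matrix (Fin (n + 1)) (Fin T) ℂ) (i : Fin (n + 1)) :
    norm12 S = rowNorm S i + norm12 (S.submatrix i.succAbove id) :=
  Fin.sum_univ_succAbove (rowNorm S) i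

theorem norm12_submatrix_equiv {k : ℕ} (S : Matrix (Fin n) (Fin T) ℂ) (e : Fin k ≃ Fin n) :
    norm12 (S.submatrix e id) = norm12 S :=
  e.sum_comp (rowNorm S)

theorem continuous_norm12 : Continuous (norm12 : Matrix (Fin n) (Fin T) ℂ → ℝ) :=
  continuous_finsetSum _ fun i _ => continuous_l2norm.comp (continuous_apply i)

/-- The real inner product `Re tr(Mᴴ N)` on matrices, whose squared norm is `frobSq`. -/
def frobInner (M N : Matrix (Fin m) (Fin T) ℂ) : ℝ := (Mᴴ * N).trace.re

theorem frobSq_eq_frobInner_self (M : Matrix (Fin m) (Fin T) ℂ) : frobSq M = frobInner M M := by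
  rw [frobSq, Finset.sum_comm, frobInner, Matrix.trace, Complex.re_sum]
  refine Finset.sum_congr rfl fun t _ => ?_
  rw [Matrix.diag_apply, Matrix.mul_apply, Complex.re_sum]
  refine Finset.sum_congr rfl fun k _ => ?_
  rw [Matrix.conjTranspose_apply, Complex.star_def, ← Complex.normSq_eq_conj_mul_self,
    Complex.ofReal_re, Complex.sq_norm]

theorem frobInner_comm (M N : Matrix (Fin m) (Fin T) ℂ) : frobInner M N = frobInner N M := by
  rw [frobInner, frobInner, ← Complex.conj_re, ← Complex.star_def, ← Matrix.trace_conjTranspose,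
    Matrix.conjTranspose_mul, Matrix.conjTranspose_conjTranspose]

theorem frobInner_sub_left (M M' N : Matrix (Fin m) (Fin T) ℂ) :
    frobInner (M - M') N = frobInner M N - frobInner M' N := by
  simp only [frobInner, Matrix.conjTranspose_sub, Matrix.sub_mul, Matrix.trace_sub, Complex.sub_re]

theorem frobInner_smul_left (c : ℝ) (M N : Matrix (Fin m) (Fin T) ℂ) :
    frobInner (c • M) N = c * frobInner M N := by
  simp only [frobInner, Matrix.conjTranspose_smul, star_trivial, Matrix.smul_mul,
    Matrix.trace_smul, Complex.smul_re, smul_eq_mul]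

theorem frobSq_sub_smul (M N : Matrix (Fin m) (Fin T) ℂ) (t : ℝ) :
    frobSq (M - t • N) = frobSq M - 2 * t * frobInner N M + t ^ 2 * frobSq N := by
  rw [frobSq_eq_frobInner_self, frobSq_eq_frobInner_self, frobSq_eq_frobInner_self,
    frobInner_sub_left, frobInner_smul_left, frobInner_comm M (M - t • N),
    frobInner_comm N (M - t • N), frobInner_sub_left, frobInner_sub_left, frobInner_smul_left,
    frobInner_smul_left, frobInner_comm M N]
  ring

theorem frobSq_nonneg (M : Matrix (Fin m) (Fin T) ℂ) : 0 ≤ frobSq M :=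
  Finset.sum_nonneg fun _ _ => Finset.sum_nonneg fun _ _ => sq_nonneg _

theorem frobSq_eq_zero {M : Matrix (Fin m) (Fin T) ℂ} : frobSq M = 0 ↔ M = 0 := by
  simp only [frobSq, Finset.sum_eq_zero_iff_of_nonneg, Finset.sum_nonneg, sq_nonneg,
    Finset.mem_univ, implies_true, forall_const, sq_eq_zero_iff, norm_eq_zero,
    ← Matrix.ext_iff, Matrix.zero_apply]

theorem continuous_frobSq : Continuous (frobSq : Matrix (Fin m) (Fin T) ℂ → ℝ) :=
  continuous_finsetSum _ fun k _ => continuous_finsetSum _ fun t _ =>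
    ((continuous_id.matrix_elem k t).norm).pow 2

end Norms

section Steering

variable {m n T : ℕ} (a : ℝ → Fin m → ℂ)

theorem steering_mul_succAbove (θ : Fin (n + 1) → ℝ) (S : Matrix (Fin (n + 1)) (Fin T) ℂ)
    (i : Fin (n + 1)) :
    steering a θ * S = Matrix.vecMulVec (a (θ i)) (S i) +
      steering a (θ ∘ i.succAbove) * S.submatrix i.succAbove id := by
  ext k t
  exact Fin.sum_univ_succAbove (fun j => a (θ j) k * S j t) i

theorem steering_mul_single (θ : Fin n → ℝ) (i : Fin n) (v : Fin T → ℂ) :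
    steering a θ * Matrix.of (Pi.single i v) = Matrix.vecMulVec (a (θ i)) v := by
  ext k t
  rw [Matrix.mul_apply, Finset.sum_eq_single i]
  · rw [Matrix.of_apply, Pi.single_eq_same, Matrix.vecMulVec_apply, steering, Matrix.of_apply]
  · intro j _ hj
    rw [Matrix.of_apply, Pi.single_eq_of_ne hj, Pi.zero_apply, mul_zero]
  · exact fun hi => (hi (Finset.mem_univ i)).elim

theorem steering_append_mul {k : ℕ} (θ : Fin n → ℝ) (θ' : Fin k → ℝ)
    (S : Matrix (Fin n) (Fin T) ℂ) (S' : Matrix (Fin k) (Fin T) ℂ) :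
    steering a (Fin.append θ θ') * Matrix.of (Fin.append S S') =
      steering a θ * S + steering a θ' * S' := by
  ext j t
  simp only [Matrix.mul_apply, Matrix.add_apply, steering, Matrix.of_apply, Fin.sum_univ_add,
    Fin.append_left S S', Fin.append_left θ θ', Fin.append_right S S', Fin.append_right θ θ']

theorem steering_comp_equiv_mul {k : ℕ} (θ : Fin n → ℝ) (S : Matrix (Fin n) (Fin T) ℂ)
    (e : Fin k ≃ Fin n) : steering a (θ ∘ e) * S.submatrix e id = steering a θ * S :=
  Matrix.submatrix_mul_equiv (steering a θ) S id e id

theorem conjTranspose_steering_mul_mul_apply (θ : Fin n → ℝ) (N : Matrix (Fin m) (Fin T) ℂ)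
    (S : Matrix (Fin n) (Fin T) ℂ) (i : Fin n) :
    ((steering a θ)ᴴ * N * Sᴴ) i i = (star (a (θ i)) ᵥ* N) ⬝ᵥ star (S i) := rfl

theorem frobInner_steering_mul (θ : Fin n → ℝ) (S : Matrix (Fin n) (Fin T) ℂ)
    (N : Matrix (Fin m) (Fin T) ℂ) :
    frobInner (steering a θ * S) N = ∑ i, ((star (a (θ i)) ᵥ* N) ⬝ᵥ star (S i)).re := by
  rw [frobInner, Matrix.conjTranspose_mul, Matrix.mul_assoc, Matrix.trace_mul_comm, Matrix.trace,
    Complex.re_sum]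
  rfl

end Steering

section Irreducible

variable {m n T : ℕ} {a : ℝ → Fin m → ℂ} {Θ : Set ℝ}

theorem exists_shorter_of_not_isIrreducible {θ : Fin (n + 1) → ℝ}
    {S : Matrix (Fin (n + 1)) (Fin T) ℂ} (hθ : ∀ i, θ i ∈ Θ) (h : ¬ IsIrreducible Θ θ S) :
    ∃ (θ' : Fin n → ℝ) (S' : Matrix (Fin n) (Fin T) ℂ), (∀ i, θ' i ∈ Θ) ∧
      steering a θ' * S' = steering a θ * S ∧ norm12 S' ≤ norm12 S := by
  by_cases hzero : ∃ i, S i = 0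
  · obtain ⟨i, hi⟩ := hzero
    refine ⟨θ ∘ i.succAbove, S.submatrix i.succAbove id, fun j => hθ _, ?_, ?_⟩
    · have hrow : Matrix.vecMulVec (a (θ i)) (S i) = 0 := by
        ext k t
        rw [hi, Matrix.vecMulVec_apply, Pi.zero_apply, mul_zero, Matrix.zero_apply]
      rw [steering_mul_succAbove a θ S i, hrow, zero_add]
    · rw [norm12_succAbove S i]
      exact le_add_of_nonneg_left (rowNorm_nonneg S i)
  · have hinj : ¬ Function.Injective θ := fun hinj => h ⟨hinj, hθ, fun i hi => hzero ⟨i, hi⟩⟩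
    obtain ⟨j, i, hij, hne⟩ := Function.not_injective_iff.1 hinj
    obtain ⟨j, rfl⟩ := Fin.exists_succAbove_eq hne
    refine ⟨θ ∘ i.succAbove, Matrix.of (Pi.single j (S i)) + S.submatrix i.succAbove id,
      fun j => hθ _, ?_, ?_⟩
    · rw [Matrix.mul_add, steering_mul_single, Function.comp_apply, hij,
        ← steering_mul_succAbove]
    · rw [norm12_succAbove S i, rowNorm, ← norm12_single j (S i)]
      exact norm12_add_le _ _

theorem exists_isIrreducible (a : ℝ → Fin m → ℂ) {θ : Fin n → ℝ} (S : Matrix (Fin n) (Fin T) ℂ)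
    (hθ : ∀ i, θ i ∈ Θ) :
    ∃ (k : ℕ) (θ' : Fin k → ℝ) (S' : Matrix (Fin k) (Fin T) ℂ), IsIrreducible Θ θ' S' ∧
      steering a θ' * S' = steering a θ * S ∧ norm12 S' ≤ norm12 S ∧
      k ≤ n ∧ (k = n → IsIrreducible Θ θ S) := by
  by_cases h : IsIrreducible Θ θ S
  · exact ⟨n, θ, S, h, rfl, le_rfl, le_rfl, fun _ => h⟩
  · induction n with
    | zero => exact (h ⟨fun i => i.elim0, fun i => i.elim0, fun i => i.elim0⟩).elim
    | succ n ih =>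
      obtain ⟨θ₁, S₁, hθ₁, hprod₁, hnorm₁⟩ := exists_shorter_of_not_isIrreducible hθ h
      by_cases h₁ : IsIrreducible Θ θ₁ S₁
      · exact ⟨n, θ₁, S₁, h₁, hprod₁, hnorm₁, n.le_succ, fun hn => by lia⟩
      · obtain ⟨k, θ₂, S₂, h₂, hprod₂, hnorm₂, hk, -⟩ := ih S₁ hθ₁ h₁
        exact ⟨k, θ₂, S₂, h₂, hprod₂.trans hprod₁, hnorm₂.trans hnorm₁, hk.trans n.le_succ,
          fun hn => by lia⟩

theorem IsConsistent.exists_equiv {θ θ' : Fin n → ℝ} {S S' : Matrix (Fin n) (Fin T) ℂ}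
    (h : IsConsistent a Θ θ S) (hθ' : ∀ i, θ' i ∈ Θ)
    (hprod : steering a θ' * S' = steering a θ * S) (hnorm : norm12 S' ≤ norm12 S) :
    ∃ e : Fin n ≃ Fin n, θ' = θ ∘ e ∧ S' = S.submatrix e id := by
  have hmin : ∀ {k : ℕ} {θ₁ : Fin k → ℝ} {S₁ : Matrix (Fin k) (Fin T) ℂ}, IsIrreducible Θ θ₁ S₁ →
      steering a θ₁ * S₁ = steering a θ * S → norm12 S₁ ≤ norm12 S →
      ∃ e : Fin k ≃ Fin n, θ₁ = θ ∘ e ∧ S₁ = S.submatrix e id := fun h₁ hprod₁ hnorm₁ =>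
    h.2 _ _ _ ⟨h₁, hprod₁, fun l θ₂ S₂ h₂ hprod₂ => hnorm₁.trans (h.1.2.2 l θ₂ S₂ h₂ hprod₂)⟩
  obtain ⟨k, θ₁, S₁, h₁, hprod₁, hnorm₁, -, hk⟩ := exists_isIrreducible a S' hθ'
  obtain ⟨e, -⟩ := hmin h₁ (hprod₁.trans hprod) (hnorm₁.trans hnorm)
  exact hmin (hk (Fin.equiv_iff_eq.1 ⟨e⟩)) hprod hnorm

end Irreducible

section Normalized

variable {n T : ℕ}

/-- The diagonal matrix of a real vector, with complex entries. -/
def complexDiagonal (q : Fin n → ℝ) : Matrix (Fin n) (Fin n) ℂ :=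
  Matrix.diagonal fun i => (q i : ℂ)

theorem complexDiagonal_smul (c : ℝ) (q : Fin n → ℝ) :
    complexDiagonal (c • q) = c • complexDiagonal q := by
  rw [complexDiagonal, complexDiagonal, ← Matrix.diagonal_smul]
  exact congrArg Matrix.diagonal (funext fun i => Complex.ofReal_mul c (q i))

theorem tendsto_complexDiagonal {ι : Type*} {F : Filter ι} {qs : ι → Fin n → ℝ} {q : Fin n → ℝ}
    (h : Tendsto qs F (𝓝 q)) :
    Tendsto (fun k => complexDiagonal (qs k)) F (𝓝 (complexDiagonal q)) :=
  (continuous_pi fun i => Complex.continuous_ofReal.comp (continuous_apply i)).matrix_diagonal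
    |>.tendsto q |>.comp h

theorem Gam_inv {S : Matrix (Fin n) (Fin T) ℂ} (hS : ∀ i, S i ≠ 0) :
    (Gam S)⁻¹ = Matrix.diagonal fun i => (rowNorm S i)⁻¹ := by
  refine Matrix.inv_eq_right_inv ?_
  rw [Gam, Matrix.diagonal_mul_diagonal, ← Matrix.diagonal_one]
  exact congrArg Matrix.diagonal (funext fun i => mul_inv_cancel₀ (rowNorm_pos (hS i)).ne')

theorem normalized_row {S : Matrix (Fin n) (Fin T) ℂ} (hS : ∀ i, S i ≠ 0) (i : Fin n) :
    normalized S i = (rowNorm S i)⁻¹ • S i := by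
  funext t
  rw [normalized, Gam_inv hS, Matrix.diagonal_map Complex.ofReal_zero, Matrix.diagonal_mul,
    Pi.smul_apply, Complex.real_smul]

theorem complexDiagonal_Gam_mulVec_mul_normalized {S : Matrix (Fin n) (Fin T) ℂ}
    (hS : ∀ i, S i ≠ 0) (q : Fin n → ℝ) :
    complexDiagonal (Gam S *ᵥ q) * normalized S = complexDiagonal q * S := by
  ext i t
  rw [complexDiagonal, complexDiagonal, Matrix.diagonal_mul, Matrix.diagonal_mul,
    normalized_row hS, Pi.smul_apply, ← Complex.real_smul, ← Complex.real_smul, smul_smul, Gam,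
    Matrix.mulVec_diagonal, mul_right_comm, mul_inv_cancel₀ (rowNorm_pos (hS i)).ne', one_mul]

theorem isUnit_det_Gam {S : Matrix (Fin n) (Fin T) ℂ} (hS : ∀ i, S i ≠ 0) :
    IsUnit (Gam S).det := by
  rw [Gam, Matrix.det_diagonal, isUnit_iff_ne_zero]
  exact Finset.prod_ne_zero_iff.2 fun i _ => (rowNorm_pos (hS i)).ne'

theorem tendsto_normalized {ι : Type*} {F : Filter ι} {Ss : ι → Matrix (Fin n) (Fin T) ℂ}
    {S : Matrix (Fin n) (Fin T) ℂ} (h : Tendsto Ss F (𝓝 S)) (hS : ∀ i, S i ≠ 0) :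
    Tendsto (fun k => normalized (Ss k)) F (𝓝 (normalized S)) := by
  have hGam : Tendsto (fun k => Gam (Ss k)) F (𝓝 (Gam S)) :=
    (continuous_pi fun i => continuous_l2norm.comp (continuous_apply i)).matrix_diagonal.tendsto S
      |>.comp h
  exact tendsto_matrix_mul ((Continuous.matrix_map continuous_id Complex.continuous_ofReal).tendsto
    _ |>.comp (tendsto_matrix_inv hGam (isUnit_det_Gam hS))) h

end Normalized

section Optimality

variable {m n T : ℕ} {a : ℝ → Fin m → ℂ} {Θ : Set ℝ} {X : Matrix (Fin m) (Fin T) ℂ} {lam : ℝ}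
  {θ : Fin n → ℝ} {S : Matrix (Fin n) (Fin T) ℂ}

theorem IsSolution.cost_le (h : IsSolution a Θ X lam θ S) (hlam : 0 ≤ lam) {k : ℕ}
    {θ' : Fin k → ℝ} (S' : Matrix (Fin k) (Fin T) ℂ) (hθ' : ∀ i, θ' i ∈ Θ) :
    cost a X lam θ S ≤ cost a X lam θ' S' := by
  obtain ⟨l, θ₁, S₁, h₁, hprod, hnorm, -⟩ := exists_isIrreducible a S' hθ'
  refine (h.2 l θ₁ S₁ h₁).trans ?_
  rw [cost, cost, hprod]
  gcongr

-- The objective is convex along the segment of measures from `(θ, S)` to `(θ', S')`, which is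
-- realized by listing both sets of indexes with the rows scaled by `1 - t` and `t`.
theorem IsSolution.frobInner_sub_le (h : IsSolution a Θ X lam θ S) (hlam : 0 ≤ lam) {k : ℕ}
    {θ' : Fin k → ℝ} (S' : Matrix (Fin k) (Fin T) ℂ) (hθ' : ∀ i, θ' i ∈ Θ) :
    frobInner (steering a θ' * S' - steering a θ * S) (X - steering a θ * S) ≤
      lam * (norm12 S' - norm12 S) := by
  set N := steering a θ' * S' - steering a θ * S with hN
  rw [← sub_nonneg]
  refine nonneg_of_forall_quadratic_nonneg (d := 1 / 2 * frobSq N) fun t ht₀ ht₁ => ?_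
  have hmem : ∀ i, Fin.append θ θ' i ∈ Θ :=
    Fin.addCases (fun i => by simpa only [Fin.append_left] using h.1.2.1 i)
      fun i => by simpa only [Fin.append_right] using hθ' i
  have hcost := h.cost_le hlam (Matrix.of (Fin.append ((1 - t) • S) (t • S'))) hmem
  have hres : X - (steering a θ * (1 - t) • S + steering a θ' * t • S') =
      X - steering a θ * S - t • N := by
    rw [hN, Matrix.mul_smul, Matrix.mul_smul]
    module
  rw [cost, cost, steering_append_mul, hres, frobSq_sub_smul, norm12_append, norm12_smul,
    norm12_smul, abs_of_pos ht₀, abs_of_nonneg (sub_nonneg.2 ht₁)] at hcost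
  linarith

theorem IsSolution.re_dotProduct_le (h : IsSolution a Θ X lam θ S) (hlam : 0 ≤ lam) {ϑ : ℝ}
    (hϑ : ϑ ∈ Θ) (v : Fin T → ℂ) :
    ((star (a ϑ) ᵥ* (X - steering a θ * S)) ⬝ᵥ star v).re ≤ lam * l2norm v := by
  have hmem : ∀ i, Fin.append θ (fun _ : Fin 1 => ϑ) i ∈ Θ :=
    Fin.addCases (fun i => by simpa only [Fin.append_left] using h.1.2.1 i)
      fun i => by simpa only [Fin.append_right] using hϑ
  have hle := h.frobInner_sub_le hlam (Matrix.of (Fin.append S (Matrix.of fun _ : Fin 1 => v))) hmem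
  rwa [steering_append_mul, add_sub_cancel_left, norm12_append, add_sub_cancel_left,
    frobInner_steering_mul, Fin.sum_univ_one, norm12, Fin.sum_univ_one] at hle

theorem IsSolution.l2norm_vecMul_residual_le (h : IsSolution a Θ X lam θ S) (hlam : 0 ≤ lam)
    {ϑ : ℝ} (hϑ : ϑ ∈ Θ) : l2norm (star (a ϑ) ᵥ* (X - steering a θ * S)) ≤ lam := by
  have hle := h.re_dotProduct_le hlam hϑ (star (a ϑ) ᵥ* (X - steering a θ * S))
  rw [re_dotProduct_star_self, sq] at hle
  rcases (l2norm_nonneg (star (a ϑ) ᵥ* (X - steering a θ * S))).eq_or_lt with hzero | hpos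
  · exact hzero.symm.trans_le hlam
  · exact le_of_mul_le_mul_right hle hpos

theorem IsSolution.re_dotProduct_eq (h : IsSolution a Θ X lam θ S) (hlam : 0 ≤ lam) (i : Fin n) :
    ((star (a (θ i)) ᵥ* (X - steering a θ * S)) ⬝ᵥ star (S i)).re = lam * rowNorm S i := by
  have hle : ∀ i, ((star (a (θ i)) ᵥ* (X - steering a θ * S)) ⬝ᵥ star (S i)).re ≤
      lam * rowNorm S i := fun i => h.re_dotProduct_le hlam (h.1.2.1 i) (S i)
  have hsum : lam * norm12 S ≤ frobInner (steering a θ * S) (X - steering a θ * S) := by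
    have hempty := h.frobInner_sub_le hlam (k := 0) (θ' := Fin.elim0) 0 fun i => i.elim0
    rw [frobInner_sub_left, Matrix.mul_zero, norm12, Fin.sum_univ_zero] at hempty
    rw [← sub_nonneg]
    simpa [frobInner] using hempty
  rw [frobInner_steering_mul, norm12, Finset.mul_sum] at hsum
  exact (Finset.sum_eq_sum_iff_of_le fun i _ => hle i).1
    ((Finset.sum_le_sum fun i _ => hle i).antisymm hsum) i (Finset.mem_univ i)

theorem IsSolution.conjTranspose_mul_residual (h : IsSolution a Θ X lam θ S) (hlam : 0 ≤ lam) :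
    (steering a θ)ᴴ * (X - steering a θ * S) = lam • normalized S := by
  refine funext fun i => (?_ : star (a (θ i)) ᵥ* (X - steering a θ * S) = lam • normalized S i)
  rw [normalized_row h.1.2.2, smul_smul]
  exact eq_smul_of_l2norm_le_of_le_re_dotProduct (h.1.2.2 i)
    (h.l2norm_vecMul_residual_le hlam (h.1.2.1 i)) (h.re_dotProduct_eq hlam i).ge

theorem hasDerivAt_re_star_vecMul_dotProduct {f : ℝ → Fin m → ℂ} {f' : Fin m → ℂ} {x : ℝ}
    (hf : HasDerivAt f f' x) (N : Matrix (Fin m) (Fin T) ℂ) (v : Fin T → ℂ) :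
    HasDerivAt (fun s => ((star (f s) ᵥ* N) ⬝ᵥ v).re) ((star f' ᵥ* N) ⬝ᵥ v).re x :=
  Complex.reCLM.hasFDerivAt.comp_hasDerivAt x <| HasDerivAt.fun_sum fun t _ =>
    (HasDerivAt.fun_sum fun k _ => ((hasDerivAt_pi.1 hf k).star.mul_const (N k t))).mul_const (v t)

theorem IsSolution.re_derivSteering_mul_residual_eq_zero (h : IsSolution a Θ X lam θ S)
    (hlam : 0 ≤ lam) {i : Fin n} (hi : θ i ∈ interior Θ) (ha : DifferentiableAt ℝ a (θ i)) :
    (((derivSteering a θ)ᴴ * (X - steering a θ * S) * (normalized S)ᴴ) i i).re = 0 := by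
  set R := X - steering a θ * S
  have hmax : IsMaxOn (fun ϑ => ((star (a ϑ) ᵥ* R) ⬝ᵥ star (S i)).re) Θ (θ i) := fun ϑ hϑ =>
    (h.re_dotProduct_le hlam hϑ (S i)).trans_eq (h.re_dotProduct_eq hlam i).symm
  have hderiv : ((star (deriv a (θ i)) ᵥ* R) ⬝ᵥ star (S i)).re = 0 :=
    (hmax.isLocalMax (mem_interior_iff_mem_nhds.1 hi)).hasDerivAt_eq_zero
      (hasDerivAt_re_star_vecMul_dotProduct ha.hasDerivAt R (star (S i)))
  rw [derivSteering, conjTranspose_steering_mul_mul_apply, normalized_row h.1.2.2, star_smul,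
    star_trivial (rowNorm S i)⁻¹, dotProduct_smul, Complex.smul_re, hderiv, smul_zero]

end Optimality

section Convergence

variable {m n T : ℕ} {a : ℝ → Fin m → ℂ} {Θ : Set ℝ} {X : Matrix (Fin m) (Fin T) ℂ} {lam : ℝ}
  {θ : Fin n → ℝ} {S : Matrix (Fin n) (Fin T) ℂ}

theorem IsSolution.cost_le_of_mul_eq (h : IsSolution a Θ X lam θ S) (hlam : 0 ≤ lam) {k : ℕ}
    {θ' : Fin k → ℝ} {S' : Matrix (Fin k) (Fin T) ℂ} (hθ' : ∀ i, θ' i ∈ Θ)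
    (hX : steering a θ' * S' = X) : cost a X lam θ S ≤ lam * norm12 S' := by
  refine (h.cost_le hlam S' hθ').trans_eq ?_
  rw [cost, hX, sub_self, frobSq_eq_zero.2 rfl, mul_zero, zero_add]

theorem IsSolution.norm12_le (h : IsSolution a Θ X lam θ S) (hlam : 0 < lam) {k : ℕ}
    {θ' : Fin k → ℝ} {S' : Matrix (Fin k) (Fin T) ℂ} (hθ' : ∀ i, θ' i ∈ Θ)
    (hX : steering a θ' * S' = X) : norm12 S ≤ norm12 S' := by
  refine le_of_mul_le_mul_left (le_trans ?_ (h.cost_le_of_mul_eq hlam.le hθ' hX)) hlam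
  exact le_add_of_nonneg_left (mul_nonneg one_half_pos.le (frobSq_nonneg _))

theorem IsSolution.frobSq_residual_le (h : IsSolution a Θ X lam θ S) (hlam : 0 ≤ lam) {k : ℕ}
    {θ' : Fin k → ℝ} {S' : Matrix (Fin k) (Fin T) ℂ} (hθ' : ∀ i, θ' i ∈ Θ)
    (hX : steering a θ' * S' = X) : frobSq (X - steering a θ * S) ≤ 2 * (lam * norm12 S') := by
  have hcost := h.cost_le_of_mul_eq hlam hθ' hX
  rw [cost] at hcost
  linarith [mul_nonneg hlam (norm12_nonneg S)]

theorem IsSolution.comp_equiv (h : IsSolution a Θ X lam θ S) {k : ℕ} (e : Fin k ≃ Fin n) :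
    IsSolution a Θ X lam (θ ∘ e) (S.submatrix e id) := by
  refine ⟨⟨h.1.1.comp e.injective, fun i => h.1.2.1 _, fun i => h.1.2.2 (e i)⟩,
    fun l θ' S' h' => ?_⟩
  rw [cost, steering_comp_equiv_mul, norm12_submatrix_equiv]
  exact h.2 l θ' S' h'

variable {ι : Type*} {F : Filter ι} {lams : ι → ℝ} {θs : ι → Fin n → ℝ}
  {Ss : ι → Matrix (Fin n) (Fin T) ℂ}

theorem tendsto_steering (h : ∀ i, Tendsto (fun k => a (θs k i)) F (𝓝 (a (θ i)))) :
    Tendsto (fun k => steering a (θs k)) F (𝓝 (steering a θ)) :=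
  tendsto_pi_nhds.2 fun j => tendsto_pi_nhds.2 fun i => (h i).apply_nhds j

theorem mul_eq_of_tendsto_isSolution [F.NeBot] (ha : ContinuousOn a Θ)
    (hlams : Tendsto lams F (𝓝[>] 0)) (hsol : ∀ᶠ k in F, IsSolution a Θ X (lams k) (θs k) (Ss k))
    (hθs : Tendsto θs F (𝓝 θ)) (hSs : Tendsto Ss F (𝓝 S)) (hθ : ∀ i, θ i ∈ Θ) {k : ℕ}
    {θ' : Fin k → ℝ} {S' : Matrix (Fin k) (Fin T) ℂ} (hθ' : ∀ i, θ' i ∈ Θ)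
    (hX : steering a θ' * S' = X) : steering a θ * S = X := by
  have hA : Tendsto (fun k => steering a (θs k)) F (𝓝 (steering a θ)) :=
    tendsto_steering fun i => (ha (θ i) (hθ i)).tendsto.comp <|
      tendsto_nhdsWithin_iff.2 ⟨hθs.apply_nhds i, hsol.mono fun k hk => hk.1.2.1 i⟩
  have hres : Tendsto (fun k => frobSq (X - steering a (θs k) * Ss k)) F
      (𝓝 (frobSq (X - steering a θ * S))) :=
    (continuous_frobSq.tendsto _).comp (tendsto_const_nhds.sub (tendsto_matrix_mul hA hSs))
  have hbound : Tendsto (fun k => 2 * (lams k * norm12 S')) F (𝓝 (2 * (0 * norm12 S'))) :=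
    (hlams.mono_right nhdsWithin_le_nhds).mul_const _ |>.const_mul 2
  have hle : frobSq (X - steering a θ * S) ≤ 2 * (0 * norm12 S') := by
    refine le_of_tendsto_of_tendsto hres hbound ?_
    filter_upwards [hsol, hlams self_mem_nhdsWithin] with k hk hpos
    exact hk.frobSq_residual_le (le_of_lt hpos) hθ' hX
  rw [zero_mul, mul_zero] at hle
  exact (sub_eq_zero.1 (frobSq_eq_zero.1 (hle.antisymm (frobSq_nonneg _)))).symm

theorem exists_tendsto_isSolution {C : ℝ} (hΘ : IsClosed Θ) {k : ℕ} {θ' : Fin k → ℝ}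
    {S' : Matrix (Fin k) (Fin T) ℂ} (hθ' : ∀ i, θ' i ∈ Θ) (hX : steering a θ' * S' = X)
    (hfreq : ∃ᶠ lam : ℝ in 𝓝[>] 0, ∃ (θ : Fin n → ℝ) (S : Matrix (Fin n) (Fin T) ℂ),
      IsSolution a Θ X lam θ S ∧ ∀ i, |θ i| ≤ C) :
    ∃ (F : Filter ℝ) (θs : ℝ → Fin n → ℝ) (Ss : ℝ → Matrix (Fin n) (Fin T) ℂ) (θ : Fin n → ℝ)
      (S : Matrix (Fin n) (Fin T) ℂ), F.NeBot ∧ F ≤ 𝓝[>] 0 ∧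
      (∀ᶠ lam in F, IsSolution a Θ X lam (θs lam) (Ss lam)) ∧
      Tendsto θs F (𝓝 θ) ∧ Tendsto Ss F (𝓝 S) ∧ ∀ i, θ i ∈ Θ := by
  have hK : IsCompact ((Set.univ.pi fun _ : Fin n => Metric.closedBall 0 C ∩ Θ) ×ˢ
      (Metric.closedBall (0 : ℂ) (norm12 S')).matrix (m := Fin n) (n := Fin T)) :=
    (isCompact_univ_pi fun _ => (isCompact_closedBall 0 C).inter_right hΘ).prod
      (isCompact_closedBall 0 _).matrix
  obtain ⟨F, hF, hne, f, ⟨θ, S⟩, hmem, hlim, hsol⟩ := exists_tendsto_of_frequently hK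
    (p := fun lam x => IsSolution a Θ X lam x.1 x.2) <| by
      refine (hfreq.and_eventually self_mem_nhdsWithin).mono ?_
      rintro lam ⟨⟨θ, S, hsol, hbound⟩, hpos⟩
      exact ⟨(θ, S), ⟨fun i _ => ⟨mem_closedBall_zero_iff.2 (hbound i), hsol.1.2.1 i⟩,
        fun i t => mem_closedBall_zero_iff.2
          ((norm_apply_le_norm12 S i t).trans (hsol.norm12_le hpos hθ' hX))⟩, hsol⟩
  exact ⟨F, fun lam => (f lam).1, fun lam => (f lam).2, θ, S, hne, hF, hsol, hlim.fst_nhds,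
    hlim.snd_nhds, fun i => (hmem.1 i trivial).2⟩

theorem IsConsistent.exists_tendsto_isSolution {C : ℝ} (h : IsConsistent a Θ θ S)
    (hΘ : IsClosed Θ) (ha : ContinuousOn a Θ)
    (hfreq : ∃ᶠ lam : ℝ in 𝓝[>] 0, ∃ (θ' : Fin n → ℝ) (S' : Matrix (Fin n) (Fin T) ℂ),
      IsSolution a Θ (steering a θ * S) lam θ' S' ∧ ∀ i, |θ' i| ≤ C) :
    ∃ (F : Filter ℝ) (θs : ℝ → Fin n → ℝ) (Ss : ℝ → Matrix (Fin n) (Fin T) ℂ), F.NeBot ∧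
      F ≤ 𝓝[>] 0 ∧ (∀ᶠ lam in F, IsSolution a Θ (steering a θ * S) lam (θs lam) (Ss lam)) ∧
      Tendsto θs F (𝓝 θ) ∧ Tendsto Ss F (𝓝 S) := by
  have hθ := h.1.1.2.1
  obtain ⟨F, θs, Ss, θ₀, S₀, hne, hF, hsol, hθs, hSs, hθ₀⟩ :=
    CLASS.exists_tendsto_isSolution hΘ hθ rfl hfreq
  have hprod := mul_eq_of_tendsto_isSolution ha hF hsol hθs hSs hθ₀ hθ rfl
  have hnorm : norm12 S₀ ≤ norm12 S := by
    refine le_of_tendsto ((continuous_norm12.tendsto S₀).comp hSs) ?_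
    filter_upwards [hsol, hF self_mem_nhdsWithin] with lam hlam hpos
    exact hlam.norm12_le hpos hθ rfl
  obtain ⟨e, rfl, rfl⟩ := h.exists_equiv hθ₀ hprod hnorm
  refine ⟨F, fun lam => θs lam ∘ e.symm, fun lam => (Ss lam).submatrix e.symm id, hne, hF,
    hsol.mono fun lam hlam => hlam.comp_equiv e.symm, ?_, ?_⟩
  · have hlim : Tendsto (fun lam => θs lam ∘ e.symm) F (𝓝 ((θ ∘ e) ∘ e.symm)) :=
      tendsto_pi_nhds.2 fun i => hθs.apply_nhds (e.symm i)
    rwa [Function.comp_assoc, e.self_comp_symm, Function.comp_id] at hlim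
  · have hlim : Tendsto (fun lam => (Ss lam).submatrix e.symm id) F
        (𝓝 ((S.submatrix e id).submatrix e.symm id)) :=
      tendsto_pi_nhds.2 fun i => hSs.apply_nhds (e.symm i)
    rwa [Matrix.submatrix_submatrix, e.self_comp_symm, Function.comp_id,
      Matrix.submatrix_id_id] at hlim

end Convergence

section Expansion

variable {m n T : ℕ}

/-- The matrix `A (AᴴA)⁻¹`, the adjoint of the Moore–Penrose inverse of a matrix `A` of full column
rank. -/
def pinvAdjoint (A : Matrix (Fin m) (Fin n) ℂ) : Matrix (Fin m) (Fin n) ℂ := A * (Aᴴ * A)⁻¹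

theorem projPerp_eq (A : Matrix (Fin m) (Fin n) ℂ) : projPerp A = 1 - pinvAdjoint A * Aᴴ := rfl

theorem projPerp_mul_self {A : Matrix (Fin m) (Fin n) ℂ} (hA : IsUnit (Aᴴ * A).det) :
    projPerp A * A = 0 := by
  rw [projPerp_eq, Matrix.sub_mul, Matrix.one_mul, pinvAdjoint, Matrix.mul_assoc, Matrix.mul_assoc,
    Matrix.nonsing_inv_mul _ hA, Matrix.mul_one, sub_self]

theorem residual_eq_of_conjTranspose_mul_residual_eq {A A' : Matrix (Fin m) (Fin n) ℂ}
    {S S' V : Matrix (Fin n) (Fin T) ℂ} (hA' : IsUnit (A'ᴴ * A').det)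
    (hV : A'ᴴ * (A * S - A' * S') = V) :
    A * S - A' * S' = pinvAdjoint A' * V - projPerp A' * (A' - A) * S := by
  have hperp : projPerp A' * (A * S - A' * S') = -(projPerp A' * (A' - A) * S) := by
    rw [Matrix.mul_sub, Matrix.mul_sub, ← Matrix.mul_assoc, ← Matrix.mul_assoc,
      projPerp_mul_self hA', Matrix.zero_mul, zero_sub, sub_zero, Matrix.neg_mul, neg_neg]
  calc A * S - A' * S'
      = pinvAdjoint A' * (A'ᴴ * (A * S - A' * S')) + projPerp A' * (A * S - A' * S') := by
        rw [projPerp_eq, Matrix.sub_mul, Matrix.one_mul, Matrix.mul_assoc, add_sub_cancel]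
    _ = pinvAdjoint A' * V - projPerp A' * (A' - A) * S := by rw [hV, hperp, ← sub_eq_add_neg]

theorem re_mul_complexDiagonal_mul_apply (M N : Matrix (Fin n) (Fin n) ℂ) (q : Fin n → ℝ)
    (i : Fin n) :
    ((M * complexDiagonal q * N) i i).re = ((M ⊙ Nᵀ).map Complex.re *ᵥ q) i := by
  rw [Matrix.mul_apply, Complex.re_sum]
  refine Finset.sum_congr rfl fun j _ => ?_
  rw [complexDiagonal, Matrix.mul_diagonal, mul_right_comm, Complex.re_mul_ofReal]
  rfl

/-- The matrix whose columns are the difference quotients of `a` from `θ i` to `θ' i`, read as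
the derivative of `a` where the two indexes agree. -/
def slopeMatrix (a : ℝ → Fin m → ℂ) (θ θ' : Fin n → ℝ) : Matrix (Fin m) (Fin n) ℂ :=
  Matrix.of fun k i => dslope a (θ i) (θ' i) k

theorem slopeMatrix_mul_complexDiagonal (a : ℝ → Fin m → ℂ) (θ θ' : Fin n → ℝ) :
    slopeMatrix a θ θ' * complexDiagonal (θ' - θ) = steering a θ' - steering a θ := by
  ext k i
  rw [complexDiagonal, Matrix.mul_diagonal, mul_comm, ← Complex.real_smul]
  exact congrFun (sub_smul_dslope a (θ i) (θ' i)) k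

theorem slopeMatrix_self (a : ℝ → Fin m → ℂ) (θ : Fin n → ℝ) :
    slopeMatrix a θ θ = derivSteering a θ := by
  ext k i
  exact congrFun (dslope_same a (θ i)) k

/-- The matrix of the linear system that the index displacement `θ' - θ` of a CLASS solution
`(θ', S')` for the data `A(θ)S` satisfies. At `(θ', S') = (θ, S)` it is `R Γ_S`. -/
def displacementMatrix (a : ℝ → Fin m → ℂ) (θ : Fin n → ℝ) (S : Matrix (Fin n) (Fin T) ℂ)
    (θ' : Fin n → ℝ) (S' : Matrix (Fin n) (Fin T) ℂ) : Matrix (Fin n) (Fin n) ℝ :=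
  (((derivSteering a θ')ᴴ * (projPerp (steering a θ') * slopeMatrix a θ θ')) ⊙
    (S * (normalized S')ᴴ)ᵀ).map Complex.re

theorem biasVec_apply (a : ℝ → Fin m → ℂ) (θ : Fin n → ℝ) (S : Matrix (Fin n) (Fin T) ℂ)
    (i : Fin n) :
    biasVec a θ S i =
      (((derivSteering a θ)ᴴ * (pinvAdjoint (steering a θ) * Xi S)) i i).re := rfl

section Solution

variable {a : ℝ → Fin m → ℂ} {Θ : Set ℝ} {lam : ℝ} {θ θ' : Fin n → ℝ}
  {S S' : Matrix (Fin n) (Fin T) ℂ}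

theorem IsSolution.residual_eq (h : IsSolution a Θ (steering a θ * S) lam θ' S') (hlam : 0 ≤ lam)
    (hA' : IsUnit ((steering a θ')ᴴ * steering a θ').det) :
    steering a θ * S - steering a θ' * S' = lam • (pinvAdjoint (steering a θ') * normalized S') -
      projPerp (steering a θ') * slopeMatrix a θ θ' * complexDiagonal (θ' - θ) * S := by
  rw [residual_eq_of_conjTranspose_mul_residual_eq hA' (h.conjTranspose_mul_residual hlam),
    Matrix.mul_smul, ← slopeMatrix_mul_complexDiagonal, ← Matrix.mul_assoc]

theorem IsSolution.displacementMatrix_mulVec (h : IsSolution a Θ (steering a θ * S) lam θ' S')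
    (hlam : 0 ≤ lam) (hA' : IsUnit ((steering a θ')ᴴ * steering a θ').det)
    (hint : ∀ i, θ' i ∈ interior Θ) (ha : ∀ i, DifferentiableAt ℝ a (θ' i)) :
    displacementMatrix a θ S θ' S' *ᵥ (θ' - θ) = lam • biasVec a θ' S' := by
  funext i
  have hzero := h.re_derivSteering_mul_residual_eq_zero hlam (hint i) (ha i)
  have hres : (derivSteering a θ')ᴴ * (steering a θ * S - steering a θ' * S') * (normalized S')ᴴ =
      lam • ((derivSteering a θ')ᴴ * (pinvAdjoint (steering a θ') * Xi S')) -
        (derivSteering a θ')ᴴ * (projPerp (steering a θ') * slopeMatrix a θ θ') *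
          complexDiagonal (θ' - θ) * (S * (normalized S')ᴴ) := by
    rw [h.residual_eq hlam hA', Xi]
    simp only [Matrix.mul_sub, Matrix.sub_mul, Matrix.mul_assoc, Matrix.mul_smul, Matrix.smul_mul]
  rw [hres, Matrix.sub_apply, Complex.sub_re, Matrix.smul_apply, Complex.smul_re,
    re_mul_complexDiagonal_mul_apply, ← biasVec_apply, sub_eq_zero] at hzero
  exact hzero.symm

end Solution

theorem displacementMatrix_self (a : ℝ → Fin m → ℂ) (θ : Fin n → ℝ)
    {S : Matrix (Fin n) (Fin T) ℂ} (hS : ∀ i, S i ≠ 0) :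
    displacementMatrix a θ S θ S = Rmat a θ S * Gam S := by
  have hrow : ∀ i j, (S * (normalized S)ᴴ) j i = Xi S j i * rowNorm S j := fun i j => by
    have hj : S j = rowNorm S j • normalized S j := by
      rw [normalized_row hS, smul_inv_smul₀ (rowNorm_pos (hS j)).ne']
    rw [mul_comm, ← Complex.real_smul]
    exact (congrArg (· ⬝ᵥ star (normalized S i)) hj).trans (smul_dotProduct _ _ _)
  ext i j
  rw [displacementMatrix, Rmat, Gam, Matrix.mul_diagonal, slopeMatrix_self, Matrix.map_apply,
    Matrix.hadamard_apply, Matrix.transpose_apply, hrow, ← mul_assoc, Complex.re_mul_ofReal,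
    ← Matrix.mul_assoc]
  rfl

theorem beta_eq (a : ℝ → Fin m → ℂ) (θ : Fin n → ℝ) (S : Matrix (Fin n) (Fin T) ℂ) :
    beta a θ S = (Rmat a θ S * Gam S)⁻¹ *ᵥ biasVec a θ S := by
  rw [Matrix.mul_inv_rev, ← Matrix.mulVec_mulVec, beta]

end Expansion

section Limits

variable {m n T : ℕ} {a : ℝ → Fin m → ℂ} {θ : Fin n → ℝ} {S : Matrix (Fin n) (Fin T) ℂ}
  {ι : Type*} {F : Filter ι} {θs : ι → Fin n → ℝ} {Ss : ι → Matrix (Fin n) (Fin T) ℂ}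

theorem tendsto_pinvAdjoint {As : ι → Matrix (Fin m) (Fin n) ℂ} {A : Matrix (Fin m) (Fin n) ℂ}
    (h : Tendsto As F (𝓝 A)) (hA : IsUnit (Aᴴ * A).det) :
    Tendsto (fun k => pinvAdjoint (As k)) F (𝓝 (pinvAdjoint A)) :=
  tendsto_matrix_mul h
    (tendsto_matrix_inv (tendsto_matrix_mul (tendsto_matrix_conjTranspose h) h) hA)

theorem tendsto_projPerp {As : ι → Matrix (Fin m) (Fin n) ℂ} {A : Matrix (Fin m) (Fin n) ℂ}
    (h : Tendsto As F (𝓝 A)) (hA : IsUnit (Aᴴ * A).det) :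
    Tendsto (fun k => projPerp (As k)) F (𝓝 (projPerp A)) :=
  tendsto_const_nhds.sub
    (tendsto_matrix_mul (tendsto_pinvAdjoint h hA) (tendsto_matrix_conjTranspose h))

theorem tendsto_steering_of_continuousAt (ha : ∀ i, ContinuousAt a (θ i))
    (hθs : Tendsto θs F (𝓝 θ)) : Tendsto (fun k => steering a (θs k)) F (𝓝 (steering a θ)) :=
  tendsto_steering fun i => (ha i).tendsto.comp (hθs.apply_nhds i)

theorem tendsto_derivSteering (ha : ∀ i, ContDiffAt ℝ 1 a (θ i)) (hθs : Tendsto θs F (𝓝 θ)) :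
    Tendsto (fun k => derivSteering a (θs k)) F (𝓝 (derivSteering a θ)) :=
  tendsto_steering fun i =>
    ((ha i).derivWithin (zero_add 1).le).continuousAt.tendsto.comp (hθs.apply_nhds i)

theorem tendsto_slopeMatrix (ha : ∀ i, DifferentiableAt ℝ a (θ i)) (hθs : Tendsto θs F (𝓝 θ)) :
    Tendsto (fun k => slopeMatrix a θ (θs k)) F (𝓝 (derivSteering a θ)) := by
  rw [← slopeMatrix_self]
  exact tendsto_pi_nhds.2 fun j => tendsto_pi_nhds.2 fun i =>
    ((continuousAt_dslope_same.2 (ha i)).tendsto.comp (hθs.apply_nhds i)).apply_nhds j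

theorem eventually_isUnit_det_gram (ha : ∀ i, ContinuousAt a (θ i)) (hθs : Tendsto θs F (𝓝 θ))
    (hA : IsUnit ((steering a θ)ᴴ * steering a θ).det) :
    ∀ᶠ k in F, IsUnit ((steering a (θs k))ᴴ * steering a (θs k)).det :=
  have hlim := tendsto_steering_of_continuousAt ha hθs
  eventually_isUnit_det (tendsto_matrix_mul (tendsto_matrix_conjTranspose hlim) hlim) hA

theorem tendsto_displacementMatrix (ha : ∀ i, ContDiffAt ℝ 1 a (θ i)) (hθs : Tendsto θs F (𝓝 θ))
    (hSs : Tendsto Ss F (𝓝 S)) (hS : ∀ i, S i ≠ 0)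
    (hA : IsUnit ((steering a θ)ᴴ * steering a θ).det) :
    Tendsto (fun k => displacementMatrix a θ S (θs k) (Ss k)) F (𝓝 (Rmat a θ S * Gam S)) := by
  have hAs := tendsto_steering_of_continuousAt (fun i => (ha i).continuousAt) hθs
  have hP := tendsto_projPerp hAs hA
  have hD := tendsto_matrix_conjTranspose (tendsto_derivSteering ha hθs)
  have hslope := tendsto_slopeMatrix (fun i => (ha i).differentiableAt one_ne_zero) hθs
  have hU := tendsto_matrix_conjTranspose (tendsto_normalized hSs hS)
  have hleft := tendsto_matrix_mul hD (tendsto_matrix_mul hP hslope)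
  have hright := tendsto_matrix_mul (tendsto_const_nhds (x := S)) hU
  rw [← displacementMatrix_self a θ hS, displacementMatrix, slopeMatrix_self]
  exact tendsto_pi_nhds.2 fun i => tendsto_pi_nhds.2 fun j =>
    (Complex.continuous_re.tendsto _).comp <|
      ((hleft.apply_nhds i).apply_nhds j).mul ((hright.apply_nhds j).apply_nhds i)

theorem tendsto_biasVec (ha : ∀ i, ContDiffAt ℝ 1 a (θ i)) (hθs : Tendsto θs F (𝓝 θ))
    (hSs : Tendsto Ss F (𝓝 S)) (hS : ∀ i, S i ≠ 0)
    (hA : IsUnit ((steering a θ)ᴴ * steering a θ).det) :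
    Tendsto (fun k => biasVec a (θs k) (Ss k)) F (𝓝 (biasVec a θ S)) := by
  have hAs := tendsto_steering_of_continuousAt (fun i => (ha i).continuousAt) hθs
  have hpinv := tendsto_pinvAdjoint hAs hA
  have hD := tendsto_matrix_conjTranspose (tendsto_derivSteering ha hθs)
  have hU := tendsto_normalized hSs hS
  have hXi := tendsto_matrix_mul hU (tendsto_matrix_conjTranspose hU)
  have hprod := tendsto_matrix_mul hD (tendsto_matrix_mul hpinv hXi)
  exact tendsto_pi_nhds.2 fun i =>
    (Complex.continuous_re.tendsto _).comp ((hprod.apply_nhds i).apply_nhds i)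

theorem neg_sub_pinvAdjoint_mul_normalized (hS : ∀ i, S i ≠ 0) :
    -((projPerp (steering a θ) * derivSteering a θ * deltaQ0 a θ S - pinvAdjoint (steering a θ)) *
      normalized S) = pinvAdjoint (steering a θ) * normalized S -
        projPerp (steering a θ) * derivSteering a θ * complexDiagonal (beta a θ S) * S := by
  rw [Matrix.sub_mul, neg_sub, Matrix.mul_assoc _ (complexDiagonal _),
    ← complexDiagonal_Gam_mulVec_mul_normalized hS, ← Matrix.mul_assoc]
  rfl

section Solution

variable {Θ : Set ℝ} {lams : ι → ℝ}

theorem tendsto_inv_smul_displacement (hlams : ∀ᶠ k in F, 0 < lams k)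
    (hsol : ∀ᶠ k in F, IsSolution a Θ (steering a θ * S) (lams k) (θs k) (Ss k))
    (hθs : Tendsto θs F (𝓝 θ)) (hSs : Tendsto Ss F (𝓝 S)) (hS : ∀ i, S i ≠ 0)
    (hint : ∀ i, θ i ∈ interior Θ) (ha : ∀ i, ContDiffAt ℝ 1 a (θ i))
    (hA : IsUnit ((steering a θ)ᴴ * steering a θ).det) (hR : IsUnit (Rmat a θ S).det) :
    Tendsto (fun k => (lams k)⁻¹ • (θs k - θ)) F (𝓝 (beta a θ S)) := by
  have hints : ∀ᶠ k in F, ∀ i, θs k i ∈ interior Θ := eventually_all.2 fun i =>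
    (hθs.apply_nhds i).eventually (isOpen_interior.mem_nhds (hint i))
  have hdiff : ∀ᶠ k in F, ∀ i, DifferentiableAt ℝ a (θs k i) := eventually_all.2 fun i =>
    (hθs.apply_nhds i).eventually <| ((ha i).eventually (by simp)).mono fun _ hx =>
      hx.differentiableAt one_ne_zero
  have hunit : IsUnit (Rmat a θ S * Gam S).det := by
    rw [Matrix.det_mul]
    exact hR.mul (isUnit_det_Gam hS)
  rw [beta_eq]
  refine tendsto_of_mulVec_eq (tendsto_displacementMatrix ha hθs hSs hS hA) hunit
    (tendsto_biasVec ha hθs hSs hS hA) ?_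
  have hgram := eventually_isUnit_det_gram (fun i => (ha i).continuousAt) hθs hA
  filter_upwards [hlams, hsol, hints, hdiff, hgram] with k hpos hk hik hdk hAk
  rw [Matrix.mulVec_smul, hk.displacementMatrix_mulVec hpos.le hAk hik hdk,
    inv_smul_smul₀ hpos.ne']

theorem tendsto_inv_smul_residual (hlams : ∀ᶠ k in F, 0 < lams k)
    (hsol : ∀ᶠ k in F, IsSolution a Θ (steering a θ * S) (lams k) (θs k) (Ss k))
    (hθs : Tendsto θs F (𝓝 θ)) (hSs : Tendsto Ss F (𝓝 S)) (hS : ∀ i, S i ≠ 0)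
    (hint : ∀ i, θ i ∈ interior Θ) (ha : ∀ i, ContDiffAt ℝ 1 a (θ i))
    (hA : IsUnit ((steering a θ)ᴴ * steering a θ).det) (hR : IsUnit (Rmat a θ S).det) :
    Tendsto (fun k => (lams k)⁻¹ • (steering a θ * S - steering a (θs k) * Ss k)) F
      (𝓝 (-((projPerp (steering a θ) * derivSteering a θ * deltaQ0 a θ S -
        pinvAdjoint (steering a θ)) * normalized S))) := by
  have hcont := fun i => (ha i).continuousAt
  have hAs := tendsto_steering_of_continuousAt hcont hθs
  have hslope := tendsto_slopeMatrix (fun i => (ha i).differentiableAt one_ne_zero) hθs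
  have hbeta := tendsto_complexDiagonal
    (tendsto_inv_smul_displacement hlams hsol hθs hSs hS hint ha hA hR)
  have hlim : Tendsto (fun k => pinvAdjoint (steering a (θs k)) * normalized (Ss k) -
      projPerp (steering a (θs k)) * slopeMatrix a θ (θs k) *
        complexDiagonal ((lams k)⁻¹ • (θs k - θ)) * S) F
      (𝓝 (pinvAdjoint (steering a θ) * normalized S -
        projPerp (steering a θ) * derivSteering a θ * complexDiagonal (beta a θ S) * S)) :=
    (tendsto_matrix_mul (tendsto_pinvAdjoint hAs hA) (tendsto_normalized hSs hS)).sub <|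
      tendsto_matrix_mul (tendsto_matrix_mul (tendsto_matrix_mul (tendsto_projPerp hAs hA) hslope)
        hbeta) tendsto_const_nhds
  rw [neg_sub_pinvAdjoint_mul_normalized hS]
  refine hlim.congr' ?_
  filter_upwards [hlams, hsol, eventually_isUnit_det_gram hcont hθs hA] with k hpos hk hAk
  rw [complexDiagonal_smul, Matrix.mul_smul, Matrix.smul_mul, hk.residual_eq hpos.le hAk, smul_sub,
    inv_smul_smul₀ hpos.ne']

end Solution

end Limits

end CLASS

end

open CLASS

theorem proposition2_general {m n T p : ℕ} {Θ : Set ℝ} (hΘ : IsClosed Θ) {a : ℝ → Fin m → ℂ}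
    (ha : ContinuousOn a Θ) {θ : Fin n → ℝ} (hdiff : ∀ i, ContDiffAt ℝ 1 a (θ i))
    {S : Matrix (Fin n) (Fin T) ℂ} (hint : ∀ i, θ i ∈ interior Θ)
    (hA : IsUnit ((steering a θ)ᴴ * steering a θ).det) (hR : IsUnit (Rmat a θ S).det)
    (hcons : IsConsistent a Θ θ S) {C : ℝ}
    (hpure : ∃ᶠ lam : ℝ in 𝓝[>] 0, ∃ (θ' : Fin n → ℝ) (S' : Matrix (Fin n) (Fin T) ℂ),
      IsSolution a Θ (steering a θ * S) lam θ' S' ∧ ∀ i, |θ' i| ≤ C)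
    {Ξhalf : Matrix (Fin n) (Fin p) ℂ} (hΞ : Ξhalf * Ξhalfᴴ = Xi S) {ϑ : ℝ} (hϑ : ϑ ∈ Θ) :
    l2norm (star (a ϑ) ᵥ* ((projPerp (steering a θ) * derivSteering a θ * deltaQ0 a θ S -
      steering a θ * ((steering a θ)ᴴ * steering a θ)⁻¹) * Ξhalf)) ≤ 1 := by
  obtain ⟨F, θs, Ss, hne, hF, hsol, hθs, hSs⟩ := hcons.exists_tendsto_isSolution hΘ ha hpure
  have hpos : ∀ᶠ lam in F, 0 < lam := hF self_mem_nhdsWithin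
  have hres := tendsto_inv_smul_residual hpos hsol hθs hSs hcons.1.1.2.2 hint hdiff hA hR
  have hdual : ∀ᶠ lam in F, l2norm (star (a ϑ) ᵥ*
      (lam⁻¹ • (steering a θ * S - steering a (θs lam) * Ss lam))) ≤ 1 := by
    filter_upwards [hpos, hsol] with lam hlam hk
    rw [Matrix.vecMul_smul, l2norm_smul, abs_of_pos (inv_pos.2 hlam), inv_mul_le_one₀ hlam]
    exact hk.l2norm_vecMul_residual_le hlam.le hϑ
  have hlim := le_of_tendsto ((continuous_l2norm.comp
    (continuous_const.matrix_vecMul continuous_id)).tendsto _ |>.comp hres) hdual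
  rw [Function.comp_apply, id, Matrix.vecMul_neg, l2norm_neg, ← Matrix.vecMul_vecMul] at hlim
  rwa [← Matrix.vecMul_vecMul, l2norm_vecMul_eq_of_mul_conjTranspose_eq _ hΞ]

theorem proposition2 {m n T : ℕ} (Θ : Set ℝ) (hΘ : IsClosed Θ)
    (a : ℝ → Fin m → ℂ) (ha : ContDiffOn ℝ ∞ a Θ)
    (θ : Fin n → ℝ) (S : Matrix (Fin n) (Fin T) ℂ)
    (hint : ∀ i, θ i ∈ interior Θ)
    (hA : IsUnit ((CLASS.steering a θ)ᴴ * CLASS.steering a θ).det)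
    (hR : IsUnit (CLASS.Rmat a θ S).det)
    (hcons : CLASS.IsConsistent a Θ θ S)
    (hpure : CLASS.IsPure a Θ θ S)
    (Ξhalf : Matrix (Fin n) (Fin n) ℂ) (hΞ : Ξhalf * Ξhalfᴴ = CLASS.Xi S) :
    ∀ ϑ ∈ Θ,
      CLASS.l2norm (star (a ϑ) ᵥ*
        ((CLASS.projPerp (CLASS.steering a θ) * CLASS.derivSteering a θ * CLASS.deltaQ0 a θ S
            - CLASS.steering a θ * ((CLASS.steering a θ)ᴴ * CLASS.steering a θ)⁻¹) * Ξhalf)) ≤ 1 := by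
  obtain ⟨C, hC⟩ := hpure
  have hdiff : ∀ i, ContDiffAt ℝ 1 a (θ i) := fun i =>
    (ha.contDiffAt (mem_interior_iff_mem_nhds.1 (hint i))).of_le (by simp)
  exact fun ϑ => proposition2_general hΘ ha.continuousOn hdiff hint hA hR hcons hC.frequently hΞ
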